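/- Let $R$ be a commutative Noetherian ring and $M$ a finitely generated $R$-module. For a finitely generated $R$-module $N$ let $\dim_R N$ denote the Krull dimension of the support of $N$ (with $\dim_R 0=-\infty$). Call $N$ Cohen--Macaulay if $\operatorname{depth}_{R_P}N_P=\dim_{R_P}N_P$ for every maximal ideal $P$ in $\operatorname{Supp}_R N$; in particular $N=0$ is Cohen--Macaulay. Let $\mathcal S(M)=\{\dim_R N \mid 0\neq N\subseteq M \text{ a submodule}\}=\{d_1<d_2<\dots<d_\ell\}$, which is a finite set. The dimension filtration of $M$ is the chain $0=D_0\subsetneq D_1\subsetneq\dots\subsetneq D_\ell=M$ in which, for $1\le i\le \ell$, $D_i$ is the largest submodule of $M$ with $\dim_R D_i\le d_i$. The module $M$ is called sequentially Cohen--Macaulay if $D_i/D_{i-1}$ is Cohen--Macaulay for every $1\le i\le\ell$. Assume that $\dim R/\mathfrak p=\dim R_P/\mathfrak pR_P$ for every $\mathfrak p\in\operatorname{Ass}_R M$ and every maximal ideal $P$ of $R$ with $\mathfrak p\subseteq P$. Then the following conditions are equivalent: (1) $M$ is a sequentially Cohen--Macaulay $R$-module; (2) $M_P$ is a sequentially Cohen--Macaulay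 $R_P$-module for every $P\in\operatorname{Supp}_R M$. -/

import Mathlib

namespace SeqCM

/-- The depth of a module over a local ring: the supremum of the lengths of the `M`-regular
sequences consisting of elements of the maximal ideal. -/
noncomputable def localDepth (R : Type*) [CommRing R] [IsLocalRing R]
    (M : Type*) [AddCommGroup M] [Module R M] : ℕ∞ :=
  ⨆ (rs : List R) (_ : (∀ r ∈ rs, r ∈ IsLocalRing.maximalIdeal R) ∧
    RingTheory.Sequence.IsRegular M rs), (rs.length : ℕ∞)

/-- A finitely generated module `M` over a Noetherian ring `R` is Cohen-Macaulay if
`depth M_P = dim M_P` over `R_P` for every maximal ideal `P` in the support of `M`.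
In particular the zero module is Cohen-Macaulay. -/
def IsCohenMacaulay (R : Type*) [CommRing R] (M : Type*) [AddCommGroup M] [Module R M] : Prop :=
  ∀ P ∈ Module.support R M, P.asIdeal.IsMaximal →
    (localDepth (Localization.AtPrime P.asIdeal) (LocalizedModule.AtPrime P.asIdeal M) :
      WithBot ℕ∞) =
    Module.supportDim (Localization.AtPrime P.asIdeal) (LocalizedModule.AtPrime P.asIdeal M)

/-- The set `𝒮(M)` of the dimensions of the nonzero submodules of `M`. -/
def dimSet (R : Type*) [CommRing R] (M : Type*) [AddCommGroup M] [Module R M] :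
    Set (WithBot ℕ∞) :=
  {e | ∃ N : Submodule R M, N ≠ ⊥ ∧ Module.supportDim R N = e}

/-- `D 0, …, D ℓ` is the dimension filtration of `M`: the set `𝒮(M)` has exactly `ℓ` elements
`d 0 < ⋯ < d (ℓ - 1)`, `D 0` is zero, and `D (i + 1)` is the largest submodule of `M` of dimension
at most `d i`. (The indices of `d` start at `0` here.) -/
structure IsDimensionFiltration (R : Type*) [CommRing R] (M : Type*) [AddCommGroup M] [Module R M]
    (l : ℕ) (D : Fin (l + 1) → Submodule R M) : Prop where
  bot : D 0 = ⊥
  largest : ∃ d : Fin l → WithBot ℕ∞, StrictMono d ∧ Set.range d = dimSet R M ∧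
    ∀ i : Fin l, IsGreatest {N : Submodule R M | Module.supportDim R N ≤ d i} (D i.succ)

/-- `M` is sequentially Cohen-Macaulay if the successive quotients `D (i + 1) / D i` of its
dimension filtration are Cohen-Macaulay. (A finitely generated module over a Noetherian ring has
exactly one dimension filtration, see below.) -/
def IsSequentiallyCohenMacaulay (R : Type*) [CommRing R] (M : Type*) [AddCommGroup M]
    [Module R M] : Prop :=
  ∃ (l : ℕ) (D : Fin (l + 1) → Submodule R M), IsDimensionFiltration R M l D ∧
    ∀ i : Fin l, IsCohenMacaulay R (D i.succ ⧸ (D i.castSucc).submoduleOf (D i.succ))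

section WellDefined

variable {R : Type*} [CommRing R] {M : Type*} [AddCommGroup M] [Module R M]

theorem supportDim_sup_le (N K : Submodule R M) (e : WithBot ℕ∞)
    (hN : Module.supportDim R N ≤ e) (hK : Module.supportDim R K ≤ e) :
    Module.supportDim R (N ⊔ K : Submodule R M) ≤ e := by
  have hsub : Module.support R (N ⊔ K : Submodule R M) ⊆
      Module.support R N ∪ Module.support R K := by
    intro p hp
    rw [Module.mem_support_iff'] at hp
    obtain ⟨⟨m, hm⟩, h⟩ := hp
    by_contra hcon
    simp only [Set.mem_union, not_or, Module.notMem_support_iff'] at hcon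
    obtain ⟨a, ha, b, hb, rfl⟩ := Submodule.mem_sup.1 hm
    obtain ⟨r, hr, hra⟩ := hcon.1 ⟨a, ha⟩
    obtain ⟨s, hs, hsb⟩ := hcon.2 ⟨b, hb⟩
    have hra' : r • a = 0 := congrArg Subtype.val hra
    have hsb' : s • b = 0 := congrArg Subtype.val hsb
    refine h (r * s) (fun hmem => ?_) ?_
    · exact (p.2.mem_or_mem hmem).elim hr hs
    · apply Subtype.ext
      change (r * s) • (a + b) = 0
      rw [smul_add, mul_smul, mul_smul, hsb', smul_zero, add_zero, smul_comm, hra', smul_zero]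
  refine iSup_le fun c => ?_
  have key : ∀ L : Submodule R M, (c.head : PrimeSpectrum R) ∈ Module.support R L →
      (c.length : WithBot ℕ∞) ≤ Module.supportDim R L := by
    intro L hL
    exact Order.LTSeries.length_le_krullDim (α := Module.support R L)
      { length := c.length
        toFun := fun i => ⟨(c i).1, Module.mem_support_mono (c.monotone (Fin.zero_le i)) hL⟩
        step := fun i => c.step i }
  rcases hsub c.head.2 with h | h
  · exact (key N h).trans hN
  · exact (key K h).trans hK

theorem exists_isGreatest [IsNoetherian R M] (e : WithBot ℕ∞) :
    ∃ D, IsGreatest {N : Submodule R M | Module.supportDim R N ≤ e} D := by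
  obtain ⟨D, hD, hmax⟩ := WellFounded.has_min
    (wellFounded_gt : WellFounded ((· > ·) : Submodule R M → Submodule R M → Prop))
    {N : Submodule R M | Module.supportDim R N ≤ e}
    ⟨⊥, by simp [Module.supportDim_eq_bot_of_subsingleton]⟩
  refine ⟨D, hD, fun N hN => ?_⟩
  by_contra hcon
  exact hmax (D ⊔ N) (supportDim_sup_le D N e hD hN) (left_lt_sup.2 hcon)

theorem dimSet_finite [IsNoetherian R M] : (dimSet R M).Finite := by
  by_contra hinf
  have hinf : (dimSet R M).Infinite := hinf
  choose F hF using fun e : WithBot ℕ∞ => exists_isGreatest (R := R) (M := M) e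
  have hmono : ∀ a b, a < b → b ∈ dimSet R M → F a < F b := by
    rintro a b hab ⟨N, -, rfl⟩
    refine lt_of_le_of_ne ((hF _).2 ((hF a).1.trans hab.le)) fun h => ?_
    have hN : N ≤ F a := by
      rw [h]
      exact (hF (Module.supportDim R N)).2 (le_refl (Module.supportDim R N))
    exact absurd ((Module.supportDim_le_of_injective _
      (Submodule.inclusion_injective hN)).trans (hF a).1) (not_le.2 hab)
  have : WellFoundedGT (dimSet R M) := by
    refine ⟨Subrelation.wf (r := InvImage (· > ·) fun x : dimSet R M => F x.1) ?_
      (InvImage.wf _ wellFounded_gt)⟩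
    intro x y hxy
    exact hmono _ _ hxy x.2
  exact hinf (Set.finite_coe_iff.1 (Finite.of_wellFoundedLT_wellFoundedGT _))

theorem exists_isDimensionFiltration [IsNoetherian R M] :
    ∃ (l : ℕ) (D : Fin (l + 1) → Submodule R M), IsDimensionFiltration R M l D := by
  choose F hF using fun e : WithBot ℕ∞ => exists_isGreatest (R := R) (M := M) e
  have hfin := dimSet_finite (R := R) (M := M)
  refine ⟨hfin.toFinset.card, Fin.cons ⊥ fun i => F (hfin.toFinset.orderEmbOfFin rfl i),
    ⟨rfl, hfin.toFinset.orderEmbOfFin rfl, OrderEmbedding.strictMono _, ?_, fun i => ?_⟩⟩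
  · simp
  · simpa using hF _

theorem IsDimensionFiltration.length_unique {l l' : ℕ} {D : Fin (l + 1) → Submodule R M}
    {D' : Fin (l' + 1) → Submodule R M} (h : IsDimensionFiltration R M l D)
    (h' : IsDimensionFiltration R M l' D') : l = l' := by
  obtain ⟨d, hd, hr, -⟩ := h.largest
  obtain ⟨d', hd', hr', -⟩ := h'.largest
  have h1 := Set.ncard_range_of_injective hd.injective
  have h2 := Set.ncard_range_of_injective hd'.injective
  rw [hr] at h1
  rw [hr'] at h2
  simpa using h1.symm.trans h2

theorem IsDimensionFiltration.unique {l : ℕ} {D D' : Fin (l + 1) → Submodule R M}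
    (h : IsDimensionFiltration R M l D) (h' : IsDimensionFiltration R M l D') : D = D' := by
  obtain ⟨d, hd, hr, hD⟩ := h.largest
  obtain ⟨d', hd', hr', hD'⟩ := h'.largest
  obtain rfl : d = d' := (StrictMono.range_inj hd hd').1 (hr.trans hr'.symm)
  funext i
  refine Fin.cases ?_ (fun i => ?_) i
  · rw [h.bot, h'.bot]
  · exact (hD i).unique (hD' i)

end WellDefined

end SeqCM

/-!
For `n : ℕ` let `T n` be the largest submodule of `M` of dimension less than `n`, and let
`G n = T (n + 1) / T n`. The nonzero terms of the dimension filtration are the `T (n + 1)` with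
`n ∈ 𝒮(M)`, each preceded by `T n`, and `G n = 0` for `n ∉ 𝒮(M)`. So `M` is sequentially
Cohen-Macaulay iff every `G n` is Cohen-Macaulay.

The submodule `T n` is characterised by associated primes: `dim R / p < n` for `p ∈ Ass (T n)` and
`dim R / p ≥ n` for `p ∈ Ass (M / T n)`. Hence, if there is a constant `c` such that
`dim R / p = dim R_P / pR_P + c` for all `p ∈ Ass M` contained in `P`, then `T (n + c)` localizes to
the submodule `T n` of `M_P`, and `G (n + c)` to its subquotient `G n`. For `P` maximal, the
hypothesis of the theorem says that `c = 0` works, which gives (2) ⇒ (1). For `P` contained in a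
maximal ideal `m`, if every `G n` is Cohen-Macaulay then `c = dim R_m / PR_m` works, and (1) ⇒ (2)
follows because Cohen-Macaulayness localizes.
-/

namespace SeqCM

open IsLocalRing RingTheory.Sequence Pointwise

section Dimension

variable {R : Type*} [CommRing R]

theorem ringKrullDim_quotient_eq_coheight (p : PrimeSpectrum R) :
    ringKrullDim (R ⧸ p.asIdeal) = Order.coheight p := by
  have hset : PrimeSpectrum.zeroLocus (p.asIdeal : Set R) = Set.Ici p := by
    ext q
    simp [PrimeSpectrum.mem_zeroLocus, ← PrimeSpectrum.asIdeal_le_asIdeal]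
  rw [ringKrullDim_quotient, Order.coheight_eq_krullDim_Ici, hset]

theorem ringKrullDim_quotient_add_one_le_of_lt {p q : Ideal R} [hp : p.IsPrime] [hq : q.IsPrime]
    (h : p < q) : ringKrullDim (R ⧸ q) + 1 ≤ ringKrullDim (R ⧸ p) := by
  change ringKrullDim (R ⧸ (⟨q, hq⟩ : PrimeSpectrum R).asIdeal) + 1 ≤
    ringKrullDim (R ⧸ (⟨p, hp⟩ : PrimeSpectrum R).asIdeal)
  rw [ringKrullDim_quotient_eq_coheight, ringKrullDim_quotient_eq_coheight]
  exact_mod_cast Order.coheight_add_one_le (a := (⟨q, hq⟩ : PrimeSpectrum R)) (b := ⟨p, hp⟩) h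

theorem eq_of_le_of_ringKrullDim_quotient_eq {p q : Ideal R} [p.IsPrime] [q.IsPrime] {n : ℕ}
    (hpq : p ≤ q) (hp : ringKrullDim (R ⧸ p) = n) (hq : ringKrullDim (R ⧸ q) = n) : p = q := by
  refine eq_of_le_of_not_lt hpq fun hlt => ?_
  have h := ringKrullDim_quotient_add_one_le_of_lt hlt
  rw [hp, hq, ENat.WithBot.add_one_le_iff] at h
  exact lt_irrefl _ h

theorem exists_supportDim_eq_natCast {N : Type*} [AddCommGroup N] [Module R N] [Nontrivial N]
    (h : Module.supportDim R N < ⊤) : ∃ n : ℕ, Module.supportDim R N = n := by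
  obtain ⟨a, ha⟩ := WithBot.ne_bot_iff_exists.1 (Module.supportDim_ne_bot_of_nontrivial R N)
  rw [← ha] at h
  obtain ⟨n, rfl⟩ := ENat.ne_top_iff_exists.1 (WithBot.coe_lt_coe.1 h).ne
  exact ⟨n, ha.symm⟩

variable {K : Type*} [AddCommGroup K] [Module R K] [Module.Finite R K]
  {N : Type*} [AddCommGroup N] [Module R N] [Module.Finite R N]
  {L : Type*} [AddCommGroup L] [Module R L]

theorem mem_support_of_mem_associatedPrimes {p P : Ideal R} [P.IsPrime]
    (hp : p ∈ associatedPrimes R N) (hpP : p ≤ P) : ⟨P, ‹_›⟩ ∈ Module.support R N :=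
  Module.mem_support_iff_of_finite.2
    ((Submodule.annihilator_top.ge.trans hp.annihilator_le).trans hpP)

theorem ringKrullDim_quotient_le_supportDim {p : Ideal R} (hp : p ∈ associatedPrimes R N) :
    ringKrullDim (R ⧸ p) ≤ Module.supportDim R N := by
  rw [Module.supportDim_eq_ringKrullDim_quotient_annihilator]
  have hle : Module.annihilator R N ≤ p :=
    Submodule.annihilator_top.ge.trans hp.annihilator_le
  exact ringKrullDim_le_of_surjective (Ideal.Quotient.factor hle)
    (Ideal.Quotient.factor_surjective hle)

variable [IsNoetherianRing R]

theorem exists_mem_associatedPrimes_le {q : PrimeSpectrum R} (hq : q ∈ Module.support R N) :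
    ∃ p ∈ associatedPrimes R N, p ≤ q.asIdeal := by
  obtain ⟨p, hp, hpq⟩ := Ideal.exists_minimalPrimes_le (Module.mem_support_iff_of_finite.1 hq)
  exact ⟨p, Module.associatedPrimes.minimalPrimes_annihilator_subset_associatedPrimes R N hp, hpq⟩

theorem supportDim_lt_iff {n : ℕ} :
    Module.supportDim R N < n ↔ ∀ p ∈ associatedPrimes R N, ringKrullDim (R ⧸ p) < n := by
  refine ⟨fun h p hp => (ringKrullDim_quotient_le_supportDim hp).trans_lt h, fun h => ?_⟩
  by_contra! hcon
  obtain ⟨c, hc⟩ := Order.le_krullDim_iff.1 hcon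
  obtain ⟨p, hp, hpc⟩ := exists_mem_associatedPrimes_le c.head.2
  have hlen := Order.length_le_coheight (x := (⟨p, hp.isPrime⟩ : PrimeSpectrum R))
    (p := c.map Subtype.val fun _ _ h => h) hpc
  refine (h p hp).not_ge ((ringKrullDim_quotient_eq_coheight ⟨p, hp.isPrime⟩).symm ▸ ?_)
  rw [← hc]
  exact_mod_cast hlen

theorem supportDim_lt_of_exact [Module.Finite R L] {f : K →ₗ[R] N} {g : N →ₗ[R] L}
    (hf : Function.Injective f) (hfg : Function.Exact f g) {n : ℕ}
    (hK : Module.supportDim R K < n) (hL : Module.supportDim R L < n) :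
    Module.supportDim R N < n :=
  supportDim_lt_iff.2 fun p hp => (associatedPrimes.subset_union_of_exact hf hfg hp).elim
    (supportDim_lt_iff.1 hK p) (supportDim_lt_iff.1 hL p)

theorem supportDim_eq_of_forall_mem_associatedPrimes [Nontrivial N] {n : ℕ}
    (h : ∀ p ∈ associatedPrimes R N, ringKrullDim (R ⧸ p) = n) : Module.supportDim R N = n := by
  obtain ⟨p, hp⟩ := associatedPrimes.nonempty R N
  refine le_antisymm (ENat.WithBot.lt_add_one_iff.1 ?_)
    (h p hp ▸ ringKrullDim_quotient_le_supportDim hp)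
  refine supportDim_lt_iff (n := n + 1).2 fun q hq => ?_
  rw [h q hq]
  exact_mod_cast n.lt_succ_self

theorem supportDim_lt_top_of_forall_mem_associatedPrimes
    (h : ∀ p ∈ associatedPrimes R N, ringKrullDim (R ⧸ p) < ⊤) : Module.supportDim R N < ⊤ := by
  have hbound : ∀ᶠ n : ℕ in Filter.atTop, ∀ p ∈ associatedPrimes R N, ringKrullDim (R ⧸ p) < n := by
    refine (Filter.eventually_all_finite (associatedPrimes.finite R N)).2 fun p hp => ?_
    have := Ideal.Quotient.nontrivial_iff.2 hp.isPrime.ne_top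
    rw [← Module.supportDim_quotient_eq_ringKrullDim]
    obtain ⟨k, hk⟩ := exists_supportDim_eq_natCast (N := R ⧸ p)
      ((Module.supportDim_quotient_eq_ringKrullDim p).trans_lt (h p hp))
    filter_upwards [Filter.eventually_gt_atTop k] with n hn
    rw [hk]
    exact_mod_cast hn
  obtain ⟨n, hn⟩ := hbound.exists
  exact (supportDim_lt_iff.2 hn).trans_le le_top

theorem mem_associatedPrimes_of_mem_associatedPrimes_quotient {K : Submodule R N} {p : Ideal R}
    (hp : p ∈ associatedPrimes R (N ⧸ K)) (hK : ⟨p, hp.isPrime⟩ ∉ Module.support R K) :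
    p ∈ associatedPrimes R N := by
  obtain ⟨hprime, y, hy⟩ := isAssociatedPrime_iff.1 hp
  obtain ⟨x, rfl⟩ := Submodule.Quotient.mk_surjective K y
  have hmem (r : R) : r ∈ p ↔ r • x ∈ K := by
    rw [hy, Submodule.mem_colon_singleton, Submodule.mem_bot, ← Submodule.Quotient.mk_smul,
      Submodule.Quotient.mk_eq_zero]
  obtain ⟨s, hsK, hsp⟩ := SetLike.not_le_iff_exists.1 (mt Module.mem_support_iff_of_finite.2 hK)
  refine isAssociatedPrime_iff.2 ⟨hprime, s • x, Ideal.ext fun r => ?_⟩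
  rw [Submodule.mem_colon_singleton, Submodule.mem_bot]
  refine ⟨fun hr => ?_, fun hr => ?_⟩
  · rw [smul_comm]
    exact congrArg Subtype.val (Module.mem_annihilator.1 hsK ⟨r • x, (hmem r).1 hr⟩)
  · refine (hprime.mem_or_mem ((hmem (r * s)).2 ?_)).resolve_right hsp
    rw [mul_smul, hr]
    exact K.zero_mem

end Dimension

section RegularSequence

universe u v

variable {A : Type u} [CommRing A] [IsLocalRing A] {N : Type v} [AddCommGroup N] [Module A N]

/-- There is an `N`-regular sequence of length `n` in the maximal ideal of `A`, that is,
`n ≤ depth N`. -/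
def HasRegularSequence (A : Type*) [CommRing A] [IsLocalRing A] (N : Type*) [AddCommGroup N]
    [Module A N] (n : ℕ) : Prop :=
  ∃ rs : List A, rs.length = n ∧ (∀ r ∈ rs, r ∈ maximalIdeal A) ∧ IsRegular N rs

theorem HasRegularSequence.of_equiv {B : Type*} [CommRing B] [IsLocalRing B] {N' : Type*}
    [AddCommGroup N'] [Module B N'] {σ : A →+* B} {τ : B →+* A} [RingHomInvPair σ τ]
    [RingHomInvPair τ σ] (e : N ≃ₛₗ[σ] N') {n : ℕ} (h : HasRegularSequence A N n) :
    HasRegularSequence B N' n := by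
  obtain ⟨rs, hl, hmem, hreg⟩ := h
  refine ⟨rs.map σ, by simpa using hl, fun b hb => ?_, (e.isRegular_congr' rs).1 hreg⟩
  obtain ⟨a, ha, rfl⟩ := List.mem_map.1 hb
  exact fun hu => hmem a ha (by simpa using hu.map τ)

theorem HasRegularSequence.nontrivial {n : ℕ} (h : HasRegularSequence A N n) : Nontrivial N :=
  let ⟨_, _, _, hreg⟩ := h
  hreg.nontrivial

theorem HasRegularSequence.of_quotSMulTop {n : ℕ} {x : A} (hxm : x ∈ maximalIdeal A)
    (hx : IsSMulRegular N x) (h : HasRegularSequence A (QuotSMulTop x N) n) :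
    HasRegularSequence A N (n + 1) :=
  let ⟨rs, hl, hmem, hreg⟩ := h
  ⟨x :: rs, by simp [hl], by simpa using ⟨hxm, hmem⟩, .cons hx hreg⟩

variable [IsNoetherianRing A] [Module.Finite A N]

open CategoryTheory Abelian in
theorem hasRegularSequence_iff_subsingleton_ext [Small.{v} A] [Nontrivial N] {n : ℕ} :
    HasRegularSequence A N n ↔ ∀ i < n, Subsingleton
      (Ext (ModuleCat.of A (Shrink.{v} (A ⧸ maximalIdeal A))) (ModuleCat.of A N) i) :=
  (ModuleCat.exists_isRegular_tfae (maximalIdeal A) n (ModuleCat.of A N)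
    (Submodule.top_ne_ideal_smul_of_le_jacobson_annihilator
      (maximalIdeal_le_jacobson _)).symm.lt_top).out 3 1

open CategoryTheory Abelian in
theorem HasRegularSequence.quotSMulTop_of_small [Small.{v} A] {n : ℕ}
    (h : HasRegularSequence A N (n + 1)) {x : A} (hxm : x ∈ maximalIdeal A)
    (hx : IsSMulRegular N x) : HasRegularSequence A (QuotSMulTop x N) n := by
  have := h.nontrivial
  have := nontrivial_quotSMulTop_of_mem_maximalIdeal N hxm
  rw [hasRegularSequence_iff_subsingleton_ext] at h ⊢
  intro i hi
  have hexact := Ext.covariant_sequence_exact₃' (ModuleCat.of A (Shrink.{v} (A ⧸ maximalIdeal A)))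
    (IsSMulRegular.smulShortComplex_shortExact (M := ModuleCat.of A N) hx) i (i + 1) rfl
  exact AddCommGrpCat.subsingleton_of_isZero <| hexact.isZero_of_both_zeros
    ((AddCommGrpCat.isZero_of_iff_subsingleton.2 (h i (by omega))).eq_zero_of_src _)
    ((AddCommGrpCat.isZero_of_iff_subsingleton.2 (h (i + 1) (by omega))).eq_zero_of_tgt _)

theorem HasRegularSequence.quotSMulTop {n : ℕ} (h : HasRegularSequence A N (n + 1)) {x : A}
    (hxm : x ∈ maximalIdeal A) (hx : IsSMulRegular N x) :
    HasRegularSequence A (QuotSMulTop x N) n := by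
  -- `Ext` needs a copy of the residue field of `A` in the universe of the module.
  let e : N ≃ₗ[A] ULift.{u} N := ULift.moduleEquiv.symm
  have hlift := (h.of_equiv e).quotSMulTop_of_small hxm ((e.isSMulRegular_congr x).1 hx)
  exact hlift.of_equiv (QuotSMulTop.congr x e).symm

end RegularSequence

section CohenMacaulay

variable {A : Type*} [CommRing A] [IsLocalRing A] {N : Type*} [AddCommGroup N] [Module A N]

/-- `N` is a nonzero Cohen-Macaulay module of dimension `n` over the local ring `A`. -/
def IsCMOfDim (A : Type*) [CommRing A] [IsLocalRing A] (N : Type*) [AddCommGroup N]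
    [Module A N] (n : ℕ) : Prop :=
  HasRegularSequence A N n ∧ Module.supportDim A N = n

theorem IsCMOfDim.nontrivial {n : ℕ} (h : IsCMOfDim A N n) : Nontrivial N :=
  h.1.nontrivial

theorem exists_hasRegularSequence_eq_localDepth [Nontrivial N] (h : localDepth A N < ⊤) :
    ∃ n : ℕ, HasRegularSequence A N n ∧ localDepth A N = n := by
  have : Nonempty {rs : List A // (∀ r ∈ rs, r ∈ maximalIdeal A) ∧ IsRegular N rs} :=
    ⟨[], by simp, IsRegular.nil A N⟩
  rw [localDepth, iSup_subtype'] at h ⊢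
  obtain ⟨rs, hrs⟩ := ENat.exists_eq_iSup_of_lt_top h
  exact ⟨rs.1.length, ⟨rs.1, rfl, rs.2⟩, hrs.symm⟩

variable [IsNoetherianRing A]

theorem supportDim_lt_top : Module.supportDim A N < ⊤ :=
  (Module.supportDim_le_ringKrullDim A N).trans_lt ringKrullDim_lt_top

theorem notMem_of_mem_associatedPrimes_of_isSMulRegular {R : Type*} [CommRing R]
    [IsNoetherianRing R] {N : Type*} [AddCommGroup N] [Module R N] {p : Ideal R}
    (hp : p ∈ associatedPrimes R N) {x : R} (hx : IsSMulRegular N x) : x ∉ p := fun hxp =>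
  (biUnion_associatedPrimes_eq_compl_regular R N).subset (Set.mem_biUnion hp hxp) hx

variable [Module.Finite A N]

theorem not_torsionBySet_le_smul_top {x : A} (hxm : x ∈ maximalIdeal A) (hx : IsSMulRegular N x)
    {s : Set A} (hs : Submodule.torsionBySet A N s ≠ ⊥) :
    ¬ Submodule.torsionBySet A N s ≤ x • ⊤ := by
  intro hle
  refine hs (Submodule.eq_bot_of_le_smul_of_le_jacobson_bot (maximalIdeal A) _
    (IsNoetherian.noetherian _) (fun c hc => ?_) (jacobson_eq_maximalIdeal ⊥ bot_ne_top).ge)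
  obtain ⟨d, -, rfl⟩ := (Submodule.mem_smul_pointwise_iff_exists _ _ _).1 (hle hc)
  refine Submodule.smul_mem_smul hxm ((Submodule.mem_torsionBySet_iff s d).2 fun a => ?_)
  refine isSMulRegular_iff_right_eq_zero_of_smul.1 hx _ ?_
  rw [smul_comm]
  exact (Submodule.mem_torsionBySet_iff s _).1 hc a

theorem exists_lt_mem_associatedPrimes_quotSMulTop {x : A} (hxm : x ∈ maximalIdeal A)
    (hx : IsSMulRegular N x) {p : Ideal A} (hp : p ∈ associatedPrimes A N) :
    ∃ q ∈ associatedPrimes A (QuotSMulTop x N), p < q := by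
  have htors : Submodule.torsionBySet A N p ≠ ⊥ := by
    obtain ⟨hprime, y, rfl⟩ := isAssociatedPrime_iff.1 hp
    refine (Submodule.ne_bot_iff _).2 ⟨y, (Submodule.mem_torsionBySet_iff _ y).2 fun a => ?_, ?_⟩
    · exact (Submodule.mem_bot A).1 (Submodule.mem_colon_singleton.1 a.2)
    · rintro rfl
      exact hprime.ne_top (by simp)
  obtain ⟨c, hcp, hcx⟩ := SetLike.not_le_iff_exists.1 (not_torsionBySet_le_smul_top hxm hx htors)
  obtain ⟨q, hq, hle⟩ := exists_le_isAssociatedPrime_of_isNoetherianRing A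
    (Submodule.Quotient.mk c : QuotSMulTop x N) (mt (Submodule.Quotient.mk_eq_zero _).1 hcx)
  have hpq : p ≤ q := fun r hr => hle <| by
    rw [Submodule.mem_colon_singleton, Submodule.mem_bot, ← Submodule.Quotient.mk_smul,
      (Submodule.mem_torsionBySet_iff _ c).1 hcp ⟨r, hr⟩, Submodule.Quotient.mk_zero]
  have hxq : x ∈ q := hle <| by
    rw [Submodule.mem_colon_singleton, Submodule.mem_bot]
    exact Module.mem_annihilator.1 (QuotSMulTop.mem_annihilator N x) _
  exact ⟨q, hq, hpq.lt_of_ne fun h =>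
    notMem_of_mem_associatedPrimes_of_isSMulRegular hp hx (h ▸ hxq)⟩

theorem length_le_ringKrullDim_quotient {N : Type*} [AddCommGroup N] [Module A N]
    [Module.Finite A N] {rs : List A} (hmem : ∀ r ∈ rs, r ∈ maximalIdeal A)
    (hreg : IsRegular N rs) {p : Ideal A} (hp : p ∈ associatedPrimes A N) :
    (rs.length : WithBot ℕ∞) ≤ ringKrullDim (A ⧸ p) := by
  have := hp.isPrime
  induction rs generalizing N p with
  | nil => exact ringKrullDim_nonneg_of_nontrivial
  | cons x rs ih =>
    obtain ⟨hx, hrs⟩ := (isRegular_cons_iff N x rs).1 hreg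
    rw [List.forall_mem_cons] at hmem
    obtain ⟨q, hq, hpq⟩ := exists_lt_mem_associatedPrimes_quotSMulTop hmem.1 hx hp
    have := hq.isPrime
    calc ((x :: rs).length : WithBot ℕ∞) = rs.length + 1 := by simp
      _ ≤ ringKrullDim (A ⧸ q) + 1 := by gcongr; exact ih hmem.2 hrs hq this
      _ ≤ ringKrullDim (A ⧸ p) := ringKrullDim_quotient_add_one_le_of_lt hpq

theorem HasRegularSequence.le_supportDim {n : ℕ} (h : HasRegularSequence A N n) :
    n ≤ Module.supportDim A N := by
  have := h.nontrivial
  obtain ⟨rs, rfl, hmem, hreg⟩ := h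
  obtain ⟨p, hp⟩ := associatedPrimes.nonempty A N
  exact (length_le_ringKrullDim_quotient hmem hreg hp).trans
    (ringKrullDim_quotient_le_supportDim hp)

theorem IsCMOfDim.ringKrullDim_quotient_eq {n : ℕ} (h : IsCMOfDim A N n) {p : Ideal A}
    (hp : p ∈ associatedPrimes A N) : ringKrullDim (A ⧸ p) = n := by
  obtain ⟨⟨rs, rfl, hmem, hreg⟩, hdim⟩ := h
  exact le_antisymm (hdim ▸ ringKrullDim_quotient_le_supportDim hp)
    (length_le_ringKrullDim_quotient hmem hreg hp)

theorem isCMOfDim_quotSMulTop_iff {n : ℕ} {x : A} (hxm : x ∈ maximalIdeal A)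
    (hx : IsSMulRegular N x) : IsCMOfDim A (QuotSMulTop x N) n ↔ IsCMOfDim A N (n + 1) := by
  have hdim : Module.supportDim A (QuotSMulTop x N) = n ↔
      Module.supportDim A N = (n + 1 : ℕ) := by
    rw [← Module.supportDim_quotSMulTop_succ_eq_supportDim hx hxm, Nat.cast_add_one,
      ENat.WithBot.add_one_cancel]
  exact ⟨fun h => ⟨h.1.of_quotSMulTop hxm hx, hdim.1 h.2⟩,
    fun h => ⟨h.1.quotSMulTop hxm hx, hdim.2 h.2⟩⟩

theorem IsCMOfDim.exists_quotSMulTop {n : ℕ} (h : IsCMOfDim A N n) {x : A}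
    (hxm : x ∈ maximalIdeal A) (hx : IsSMulRegular N x) :
    ∃ k, n = k + 1 ∧ IsCMOfDim A (QuotSMulTop x N) k := by
  have := h.nontrivial
  have := nontrivial_quotSMulTop_of_mem_maximalIdeal N hxm
  obtain ⟨k, hk⟩ := exists_supportDim_eq_natCast (N := QuotSMulTop x N)
    (supportDim_lt_top (A := A))
  obtain rfl : n = k + 1 := by
    have hdim := Module.supportDim_quotSMulTop_succ_eq_supportDim hx hxm
    rw [h.2, hk] at hdim
    exact_mod_cast hdim.symm
  exact ⟨k, rfl, (isCMOfDim_quotSMulTop_iff hxm hx).2 h⟩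

theorem localDepth_eq_supportDim_iff [Nontrivial N] :
    (localDepth A N : WithBot ℕ∞) = Module.supportDim A N ↔ ∃ n, IsCMOfDim A N n := by
  constructor
  · intro h
    obtain ⟨d, hd⟩ := exists_supportDim_eq_natCast (N := N) (supportDim_lt_top (A := A))
    have hdepth : localDepth A N = d := by exact_mod_cast h.trans hd
    obtain ⟨n, hn, hn'⟩ :=
      exists_hasRegularSequence_eq_localDepth (hdepth ▸ ENat.natCast_lt_top d)
    exact ⟨n, hn, h ▸ hn' ▸ rfl⟩
  · rintro ⟨n, hreg, hdim⟩
    have hle : localDepth A N ≤ n := iSup₂_le fun rs hrs => by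
      exact_mod_cast hdim ▸ HasRegularSequence.le_supportDim ⟨rs, rfl, hrs⟩
    obtain ⟨rs, rfl, hrs⟩ := hreg
    rw [hdim, hle.antisymm (le_iSup₂_of_le rs hrs le_rfl), ENat.WithBot.coe_eq_natCast]

end CohenMacaulay

section Transport

variable {A B : Type*} [CommRing A] [CommRing B] {N N' : Type*} [AddCommGroup N] [AddCommGroup N']
  [Module A N] [Module B N'] {σ : A →+* B} {τ : B →+* A} [RingHomInvPair σ τ] [RingHomInvPair τ σ]

theorem supportDim_le_of_semilinearEquiv (e : N ≃ₛₗ[σ] N') :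
    Module.supportDim A N ≤ Module.supportDim B N' := by
  have hmono : StrictMono (PrimeSpectrum.comap τ) :=
    Monotone.strictMono_of_injective (fun _ _ h => Ideal.comap_mono h)
      (PrimeSpectrum.comap_injective_of_surjective τ
        fun a => ⟨σ a, RingHomInvPair.comp_apply_eq⟩)
  refine Order.krullDim_le_of_strictMono
    (fun q => ⟨PrimeSpectrum.comap τ q.1, ?_⟩) fun _ _ h => hmono h
  obtain ⟨x, hx⟩ := Module.mem_support_iff'.1 q.2
  refine Module.mem_support_iff'.2 ⟨e x, fun b hb h0 => hx (τ b) hb (e.injective ?_)⟩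
  rw [map_smulₛₗ, RingHomInvPair.comp_apply_eq₂, h0, map_zero]

theorem IsCMOfDim.of_equiv [IsLocalRing A] [IsLocalRing B] (e : N ≃ₛₗ[σ] N') {n : ℕ}
    (h : IsCMOfDim A N n) : IsCMOfDim B N' n :=
  ⟨h.1.of_equiv e, h.2 ▸ (supportDim_le_of_semilinearEquiv e.symm).antisymm
    (supportDim_le_of_semilinearEquiv e)⟩

theorem isCMOfDim_localizedModule_maximalIdeal_iff [IsLocalRing A] {n : ℕ} :
    IsCMOfDim (Localization.AtPrime (maximalIdeal A))
      (LocalizedModule.AtPrime (maximalIdeal A) N) n ↔ IsCMOfDim A N n := by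
  have hunit : (maximalIdeal A).primeCompl ≤ IsUnit.submonoid A :=
    fun a ha => notMem_maximalIdeal.1 ha
  have : IsLocalization (maximalIdeal A).primeCompl A := .of_le_isUnit hunit
  have : IsLocalizedModule (maximalIdeal A).primeCompl (LinearMap.id : N →ₗ[A] N) :=
    isLocalizedModule_id _ N A
  let σ := IsLocalization.atUnits A (S := Localization.AtPrime (maximalIdeal A))
    (maximalIdeal A).primeCompl hunit
  let := RingHomInvPair.of_ringEquiv σ.toRingEquiv
  let := RingHomInvPair.symm (σ.toRingEquiv : A →+* Localization.AtPrime (maximalIdeal A))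
    (σ.toRingEquiv.symm : Localization.AtPrime (maximalIdeal A) →+* A)
  let e₀ := IsLocalizedModule.linearEquiv (maximalIdeal A).primeCompl (LinearMap.id : N →ₗ[A] N)
    (LocalizedModule.mkLinearMap (maximalIdeal A).primeCompl N)
  let e : N ≃ₛₗ[(σ.toRingEquiv : A →+* Localization.AtPrime (maximalIdeal A))]
      LocalizedModule.AtPrime (maximalIdeal A) N :=
    { e₀ with
      map_smul' a x := by
        change e₀ (a • x) = σ a • e₀ x
        rw [show σ a = algebraMap A _ a from σ.commutes a, algebraMap_smul, map_smul] }
  exact ⟨fun h => h.of_equiv e.symm, fun h => h.of_equiv e⟩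

end Transport

section CohenMacaulay

theorem isCohenMacaulay_iff {R : Type*} [CommRing R] [IsNoetherianRing R] {N : Type*}
    [AddCommGroup N] [Module R N] [Module.Finite R N] :
    IsCohenMacaulay R N ↔ ∀ P ∈ Module.support R N, P.asIdeal.IsMaximal → ∃ n,
      IsCMOfDim (Localization.AtPrime P.asIdeal) (LocalizedModule.AtPrime P.asIdeal N) n := by
  refine forall₂_congr fun P hP => imp_congr_right fun _ => ?_
  have : Nontrivial (LocalizedModule.AtPrime P.asIdeal N) := Module.mem_support_iff.1 hP
  exact localDepth_eq_supportDim_iff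

theorem isCohenMacaulay_iff_of_isLocalRing {A : Type*} [CommRing A] [IsNoetherianRing A]
    [IsLocalRing A] {N : Type*} [AddCommGroup N] [Module A N] [Module.Finite A N] :
    IsCohenMacaulay A N ↔ (Nontrivial N → ∃ n, IsCMOfDim A N n) := by
  rw [isCohenMacaulay_iff]
  constructor
  · intro h hN
    obtain ⟨n, hn⟩ := h (closedPoint A) (closedPoint_mem_support A N) (maximalIdeal.isMaximal A)
    exact ⟨n, isCMOfDim_localizedModule_maximalIdeal_iff.1 hn⟩
  · intro h P hP hmax
    obtain rfl : P = closedPoint A := PrimeSpectrum.ext (eq_maximalIdeal hmax)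
    obtain ⟨n, hn⟩ := h (Module.nonempty_support_iff.1 ⟨_, hP⟩)
    exact ⟨n, isCMOfDim_localizedModule_maximalIdeal_iff.2 hn⟩

end CohenMacaulay

section Localization

variable {A : Type*} (B : Type*) [CommRing A] [CommRing B] [Algebra A B]
  {N N' : Type*} [AddCommGroup N] [AddCommGroup N'] [Module A N] [Module A N'] [Module B N']
  [IsScalarTower A B N']

theorem localized'_smul_top (S : Submonoid A) [IsLocalization S B] (f : N →ₗ[A] N')
    [IsLocalizedModule S f] (x : A) :
    (x • ⊤ : Submodule A N).localized' B S f = algebraMap A B x • ⊤ := by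
  rw [← Submodule.ideal_span_singleton_smul, Submodule.localized'_smul, Submodule.localized'_top,
    Submodule.localized'_span, Set.image_singleton, Algebra.linearMap_apply]
  exact Submodule.ideal_span_singleton_smul _ _

variable (P : Ideal A) [P.IsPrime] [IsLocalization.AtPrime B P]

open Module.associatedPrimes in
theorem mem_associatedPrimes_iff_of_isLocalizedModule [IsNoetherianRing A] (f : N →ₗ[A] N')
    [IsLocalizedModule P.primeCompl f] {q : Ideal B} : q ∈ associatedPrimes B N' ↔
      ∃ p ∈ associatedPrimes A N, p ≤ P ∧ p.map (algebraMap A B) = q := by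
  have hunder (q : Ideal B) : q ∈ associatedPrimes B N' ↔ q.under A ∈ associatedPrimes A N := by
    rw [← preimage_comap_associatedPrimes_eq_associatedPrimes_of_isLocalizedModule P.primeCompl B f,
      Set.mem_preimage]
  constructor
  · intro hq
    refine ⟨_, (hunder q).1 hq, ?_, IsLocalization.map_under P.primeCompl B q⟩
    have h := (IsLocalization.disjoint_under_iff P.primeCompl B q).2 hq.isPrime.ne_top
    exact fun a ha => by_contra fun haP => Set.disjoint_left.1 h haP ha
  · rintro ⟨p, hp, hpP, rfl⟩
    have := hp.isPrime
    rwa [hunder, Ideal.under_map_of_isLocalizationAtPrime P hpP]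

variable [IsNoetherianRing A] [Module.Finite A N] [IsLocalRing A] [IsLocalRing B]

theorem IsCMOfDim.isLocalizedModule_of_mem_associatedPrimes {n : ℕ} (h : IsCMOfDim A N n)
    (f : N →ₗ[A] N') [IsLocalizedModule P.primeCompl f] (hP : P ∈ associatedPrimes A N) :
    IsCMOfDim B N' 0 := by
  have := IsLocalization.isNoetherianRing P.primeCompl B ‹_›
  have := Module.Finite.of_isLocalizedModule P.primeCompl (Rₚ := B) f
  have hmax : P.map (algebraMap A B) = maximalIdeal B :=
    IsLocalization.AtPrime.map_eq_maximalIdeal P B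
  have hmem : maximalIdeal B ∈ associatedPrimes B N' :=
    (mem_associatedPrimes_iff_of_isLocalizedModule B P f).2 ⟨P, hP, le_rfl, hmax⟩
  have : Nontrivial N' := by
    by_contra! hN
    exact (associatedPrimes.eq_empty_of_subsingleton (R := B) (M := N')).le hmem
  refine ⟨?_, supportDim_eq_of_forall_mem_associatedPrimes fun q hq => ?_⟩
  · exact ⟨[], rfl, by simp, IsRegular.nil B N'⟩
  · obtain ⟨p, hp, hpP, rfl⟩ := (mem_associatedPrimes_iff_of_isLocalizedModule B P f).1 hq
    have := hp.isPrime
    obtain rfl := eq_of_le_of_ringKrullDim_quotient_eq hpP (h.ringKrullDim_quotient_eq hp)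
      (h.ringKrullDim_quotient_eq hP)
    rw [hmax]
    exact ringKrullDim_eq_zero_of_field (ResidueField B)

variable {P} in
theorem IsCMOfDim.exists_mem_isSMulRegular {n : ℕ} (h : IsCMOfDim A N n)
    (hsupp : ⟨P, ‹_›⟩ ∈ Module.support A N) (hP : P ∉ associatedPrimes A N) :
    ∃ x ∈ P, IsSMulRegular N x := by
  by_contra! hnreg
  have hsub : (P : Set A) ⊆ ⋃ q ∈ associatedPrimes A N, q :=
    (biUnion_associatedPrimes_eq_compl_regular A N).symm ▸ hnreg
  obtain ⟨q, hq, hPq⟩ := (Ideal.subset_union_prime_finite (associatedPrimes.finite A N) (f := id)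
    ⊥ ⊥ fun q hq _ _ => hq.isPrime).1 hsub
  obtain ⟨p, hp, hpP⟩ := exists_mem_associatedPrimes_le hsupp
  have := hp.isPrime
  have := hq.isPrime
  have hpq : p = q := eq_of_le_of_ringKrullDim_quotient_eq (hpP.trans hPq)
    (h.ringKrullDim_quotient_eq hp) (h.ringKrullDim_quotient_eq hq)
  obtain rfl : p = P := hpP.antisymm (hPq.trans hpq.ge)
  exact hP hp

theorem IsCMOfDim.exists_isLocalizedModule {n : ℕ} (h : IsCMOfDim A N n)
    (hsupp : ⟨P, ‹_›⟩ ∈ Module.support A N) (f : N →ₗ[A] N') [IsLocalizedModule P.primeCompl f] :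
    ∃ k, IsCMOfDim B N' k ∧ ringKrullDim (A ⧸ P) + k = n := by
  induction n using Nat.strong_induction_on generalizing N N' with
  | _ n ih =>
    by_cases hP : P ∈ associatedPrimes A N
    · exact ⟨0, h.isLocalizedModule_of_mem_associatedPrimes B P f hP, by
        simp [h.ringKrullDim_quotient_eq hP]⟩
    have := IsLocalization.isNoetherianRing P.primeCompl B ‹_›
    have := Module.Finite.of_isLocalizedModule P.primeCompl (Rₚ := B) f
    obtain ⟨x, hxP, hx⟩ := h.exists_mem_isSMulRegular hsupp hP
    obtain ⟨n, rfl, hn⟩ := h.exists_quotSMulTop (le_maximalIdeal_of_isPrime P hxP) hx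
    have hxB : algebraMap A B x ∈ maximalIdeal B :=
      (IsLocalization.AtPrime.to_map_mem_maximal_iff B P x).2 hxP
    have hsuppx : ⟨P, ‹_›⟩ ∈ Module.support A (QuotSMulTop x N) := by
      rw [Module.support_quotSMulTop]
      exact ⟨hsupp, by simpa using hxP⟩
    obtain ⟨k, hk, hkn⟩ := ih n n.lt_succ_self hn hsuppx
      ((x • ⊤ : Submodule A N).toLocalizedQuotient' B P.primeCompl f)
    have hk' : IsCMOfDim B (QuotSMulTop (algebraMap A B x) N') k :=
      hk.of_equiv (Submodule.quotEquivOfEq _ _ (localized'_smul_top B P.primeCompl f x))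
    refine ⟨k + 1, (isCMOfDim_quotSMulTop_iff hxB
      (hx.of_isLocalizedModule B P.primeCompl f)).1 hk', ?_⟩
    rw [Nat.cast_add_one, Nat.cast_add_one, ← add_assoc, hkn]

end Localization

section LocalizationAtPrime

variable {R : Type*} [CommRing R] {P m : Ideal R} [P.IsPrime] [m.IsPrime]

section Tower

variable (A B : Type*) [CommRing A] [CommRing B] [Algebra R A] [Algebra R B] [Algebra A B]
  [IsScalarTower R A B] [IsLocalization.AtPrime A m] [IsLocalization.AtPrime B P]

theorem isLocalization_atPrime_map (hPm : P ≤ m) [(P.map (algebraMap R A)).IsPrime] :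
    IsLocalization.AtPrime B (P.map (algebraMap R A)) := by
  have hunder : (P.map (algebraMap R A)).under R = P :=
    Ideal.under_map_of_isLocalizationAtPrime m hPm
  have := IsLocalization.isLocalization_of_submonoid_le A B m.primeCompl P.primeCompl
    fun a ha haP => ha (hPm haP)
  refine IsLocalization.isLocalization_of_is_exists_mul_mem B
    (P.primeCompl.map (algebraMap R A)) _ ?_ fun ⟨x, hx⟩ => ?_
  · rintro _ ⟨r, hr, rfl⟩ hrP
    exact hr (hunder.le hrP)
  · obtain ⟨⟨r, s⟩, hrs⟩ := IsLocalization.surj m.primeCompl x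
    refine ⟨algebraMap R A s, r, fun hr => hx ?_, by rw [← hrs, mul_comm]⟩
    refine (Ideal.mul_unit_mem_iff_mem _ (IsLocalization.map_units A s)).1 ?_
    exact hrs ▸ Ideal.mem_map_of_mem _ hr

variable {A} in
theorem isLocalizedModule_map_primeCompl (hPm : P ≤ m) [(P.map (algebraMap R A)).IsPrime]
    {N N₁ N₂ : Type*} [AddCommGroup N] [AddCommGroup N₁] [AddCommGroup N₂] [Module R N]
    [Module R N₁] [Module R N₂] [Module A N₁] [Module A N₂] [Module B N₂] [IsScalarTower R A N₁]
    [IsScalarTower R A N₂] [IsScalarTower R B N₂] [IsScalarTower A B N₂] (f : N →ₗ[R] N₁)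
    [IsLocalizedModule m.primeCompl f] (g : N₁ →ₗ[A] N₂)
    [IsLocalizedModule P.primeCompl (g.restrictScalars R ∘ₗ f)] :
    IsLocalizedModule (P.map (algebraMap R A)).primeCompl g := by
  have := isLocalization_atPrime_map (P := P) A B hPm
  rw [isLocalizedModule_iff_isBaseChange _ B]
  exact .of_comp (IsLocalizedModule.isBaseChange m.primeCompl A f)
    (IsLocalizedModule.isBaseChange P.primeCompl B _)

end Tower

theorem IsCMOfDim.exists_localizedModule_of_le [IsNoetherianRing R] {N : Type*} [AddCommGroup N]
    [Module R N] [Module.Finite R N] (hPm : P ≤ m) {n : ℕ}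
    (h : IsCMOfDim (Localization.AtPrime m) (LocalizedModule.AtPrime m N) n)
    (hsupp : ⟨P, ‹_›⟩ ∈ Module.support R N) :
    ∃ k, IsCMOfDim (Localization.AtPrime P) (LocalizedModule.AtPrime P N) k ∧
      ringKrullDim (Localization.AtPrime m ⧸ P.map (algebraMap R (Localization.AtPrime m))) + k =
        n := by
  let A := Localization.AtPrime m
  let B := Localization.AtPrime P
  let N' := LocalizedModule.AtPrime P N
  let f := LocalizedModule.mkLinearMap m.primeCompl N
  let PA := P.map (algebraMap R A)
  have hPA : PA.IsPrime := Ideal.isPrime_map_of_isLocalizationAtPrime m hPm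
  have hle : m.primeCompl ≤ P.primeCompl := fun a ha haP => ha (hPm haP)
  let : Algebra A B := IsLocalization.localizationAlgebraOfSubmonoidLe A B _ _ hle
  have : IsScalarTower R A B :=
    IsLocalization.localization_isScalarTower_of_submonoid_le A B _ _ hle
  let : Module A N' := Module.compHom N' (algebraMap A B)
  have : IsScalarTower A B N' := IsScalarTower.of_algebraMap_smul fun _ _ => rfl
  have : IsScalarTower R A N' := IsScalarTower.to₁₂₄ R A B N'
  let g : LocalizedModule.AtPrime m N →ₗ[A] N' :=
    (LocalizedModule.liftOfLE m.primeCompl P.primeCompl hle).extendScalarsOfIsLocalization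
      m.primeCompl A
  have hgf : g.restrictScalars R ∘ₗ f = LocalizedModule.mkLinearMap P.primeCompl N :=
    IsLocalizedModule.liftOfLE_comp _ _ hle f (LocalizedModule.mkLinearMap P.primeCompl N)
  have : IsLocalizedModule P.primeCompl (g.restrictScalars R ∘ₗ f) := by rw [hgf]; infer_instance
  have : IsLocalization.AtPrime B PA := isLocalization_atPrime_map A B hPm
  have : IsLocalizedModule PA.primeCompl g := isLocalizedModule_map_primeCompl B hPm f g
  refine h.exists_isLocalizedModule B PA ?_ g
  rw [Module.mem_support_iff] at hsupp ⊢
  exact (IsLocalizedModule.linearEquiv PA.primeCompl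
    (LocalizedModule.mkLinearMap PA.primeCompl _) g).toEquiv.nontrivial

end LocalizationAtPrime

section Truncation

variable {R : Type*} [CommRing R] {M : Type*} [AddCommGroup M] [Module R M]

variable (R M) in
/-- The largest submodule of `M` of dimension less than `n`; see `isGreatest_dimTrunc`. Indexing by
all `n : ℕ`, rather than by the dimensions that occur, makes these submodules comparable with those
of a localization of `M`. -/
def dimTrunc (n : ℕ) : Submodule R M :=
  sSup {N | Module.supportDim R N < n}

theorem isGreatest_dimTrunc [IsNoetherian R M] (n : ℕ) :
    IsGreatest {N : Submodule R M | Module.supportDim R N < n} (dimTrunc R M n) := by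
  suffices h : ∃ D, IsGreatest {N : Submodule R M | Module.supportDim R N < n} D by
    obtain ⟨D, hD⟩ := h
    rwa [dimTrunc, hD.isLUB.sSup_eq]
  cases n with
  | zero => simpa only [Nat.cast_zero, WithBot.lt_zero_iff_eq_bot, le_bot_iff] using
      exists_isGreatest (R := R) (M := M) ⊥
  | succ n => simpa only [Nat.cast_add_one, ENat.WithBot.lt_add_one_iff] using
      exists_isGreatest (R := R) (M := M) n

theorem supportDim_dimTrunc_lt [IsNoetherian R M] (n : ℕ) :
    Module.supportDim R (dimTrunc R M n) < n :=
  (isGreatest_dimTrunc n).1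

theorem le_dimTrunc {n : ℕ} {N : Submodule R M} (h : Module.supportDim R N < n) :
    N ≤ dimTrunc R M n :=
  le_sSup h

theorem supportDim_range_eq {N : Type*} [AddCommGroup N] [Module R N] {p : Ideal R}
    {φ : (R ⧸ p) →ₗ[R] N} (hφ : Function.Injective φ) :
    Module.supportDim R φ.range = ringKrullDim (R ⧸ p) := by
  rw [← Module.supportDim_eq_of_equiv (LinearEquiv.ofInjective φ hφ),
    Module.supportDim_quotient_eq_ringKrullDim]

variable (R M) in
/-- The part of `M` of dimension exactly `n`: the `n`-th graded piece of the filtration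
`dimTrunc R M`. -/
abbrev dimGraded (n : ℕ) : Type _ :=
  dimTrunc R M (n + 1) ⧸ (dimTrunc R M n).submoduleOf (dimTrunc R M (n + 1))

theorem support_dimGraded_subset (n : ℕ) :
    Module.support R (dimGraded R M n) ⊆ Module.support R M :=
  (Module.support_subset_of_surjective _ (Submodule.mkQ_surjective _)).trans
    (Module.support_subset_of_injective _ (Submodule.injective_subtype _))

variable [IsNoetherianRing R] [Module.Finite R M]

theorem eq_dimTrunc {n : ℕ} {E : Submodule R M} (hE : Module.supportDim R E < n)
    (hquot : ∀ p ∈ associatedPrimes R (M ⧸ E), (n : WithBot ℕ∞) ≤ ringKrullDim (R ⧸ p)) :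
    E = dimTrunc R M n := by
  refine le_antisymm (le_dimTrunc hE) ?_
  rw [← E.ker_mkQ, LinearMap.le_ker_iff_map]
  by_contra hne
  have : Nontrivial ((dimTrunc R M n).map E.mkQ) := Submodule.nontrivial_iff_ne_bot.2 hne
  obtain ⟨p, hp⟩ := associatedPrimes.nonempty R ((dimTrunc R M n).map E.mkQ)
  have hle : Module.supportDim R ((dimTrunc R M n).map E.mkQ) ≤
      Module.supportDim R (dimTrunc R M n) :=
    Module.supportDim_le_of_surjective (E.mkQ.submoduleMap _)
      (LinearMap.submoduleMap_surjective _ _)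
  have hn := hquot p (associatedPrimes.subset_of_injective (Submodule.injective_subtype _) hp)
  exact ((hn.trans (ringKrullDim_quotient_le_supportDim hp)).trans hle).not_gt
    (supportDim_dimTrunc_lt n)

theorem le_ringKrullDim_of_mem_associatedPrimes_quotient_dimTrunc {n : ℕ} {p : Ideal R}
    (hp : p ∈ associatedPrimes R (M ⧸ dimTrunc R M n)) :
    (n : WithBot ℕ∞) ≤ ringKrullDim (R ⧸ p) := by
  by_contra! hlt
  obtain ⟨hprime, φ, hφ⟩ := (isAssociatedPrime_iff_exists_injective_linearMap _ _).1 hp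
  let T := dimTrunc R M n
  let L := φ.range.comap T.mkQ
  have hTL : T ≤ L := by simpa only [T.ker_mkQ] using LinearMap.ker_le_comap (T.mkQ)
  have hexact : Function.Exact (Submodule.inclusion hTL)
      (T.mkQ.restrict fun x hx => hx : L →ₗ[R] φ.range) := fun y => by
    rw [← Subtype.coe_inj, LinearMap.coe_restrict_apply, ZeroMemClass.coe_zero,
      Submodule.mkQ_apply, Submodule.Quotient.mk_eq_zero]
    exact ⟨fun h => ⟨⟨y, h⟩, rfl⟩, by rintro ⟨z, rfl⟩; exact z.2⟩
  have hLT : L ≤ T := le_dimTrunc <| supportDim_lt_of_exact (Submodule.inclusion_injective hTL)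
    hexact (supportDim_dimTrunc_lt n) ((supportDim_range_eq hφ).trans_lt hlt)
  have hbot : φ.range = ⊥ := by
    rw [← Submodule.map_comap_eq_of_surjective T.mkQ_surjective φ.range,
      ← LinearMap.le_ker_iff_map, T.ker_mkQ]
    exact hLT
  have := Ideal.Quotient.nontrivial_iff.2 hprime.ne_top
  exact LinearMap.ne_zero_of_injective hφ (LinearMap.range_eq_bot.1 hbot)

theorem associatedPrimes_quotient_dimTrunc_subset (n : ℕ) :
    associatedPrimes R (M ⧸ dimTrunc R M n) ⊆ associatedPrimes R M := by
  refine fun p hp => mem_associatedPrimes_of_mem_associatedPrimes_quotient hp fun hsupp => ?_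
  obtain ⟨q, hq, hqp⟩ := exists_mem_associatedPrimes_le hsupp
  have hle := ringKrullDim_le_of_surjective (Ideal.Quotient.factor hqp)
    (Ideal.Quotient.factor_surjective hqp)
  exact ((le_ringKrullDim_of_mem_associatedPrimes_quotient_dimTrunc hp).trans hle).not_gt
    (supportDim_lt_iff.1 (supportDim_dimTrunc_lt n) q hq)

theorem mem_associatedPrimes_dimGraded {n : ℕ} {p : Ideal R} (hp : p ∈ associatedPrimes R M)
    (hn : ringKrullDim (R ⧸ p) = n) : p ∈ associatedPrimes R (dimGraded R M n) := by
  have hsucc : ringKrullDim (R ⧸ p) < (n + 1 : ℕ) := by rw [hn]; exact_mod_cast n.lt_succ_self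
  have hpT : p ∈ associatedPrimes R (dimTrunc R M (n + 1)) := by
    obtain ⟨hprime, φ, hφ⟩ := (isAssociatedPrime_iff_exists_injective_linearMap _ _).1 hp
    have hle := le_dimTrunc ((supportDim_range_eq hφ).trans_lt hsucc)
    exact (isAssociatedPrime_iff_exists_injective_linearMap _ _).2 ⟨hprime,
      Submodule.inclusion hle ∘ₗ φ.rangeRestrict,
      (Submodule.inclusion_injective hle).comp ((LinearMap.injective_rangeRestrict_iff _).2 hφ)⟩
  refine (associatedPrimes.subset_union_of_exact (Submodule.injective_subtype _)
    (LinearMap.exact_subtype_mkQ _) hpT).resolve_left fun h => ?_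
  have hle : dimTrunc R M n ≤ dimTrunc R M (n + 1) :=
    le_dimTrunc ((supportDim_dimTrunc_lt n).trans (by exact_mod_cast n.lt_succ_self))
  have hpn : p ∈ associatedPrimes R (dimTrunc R M n) :=
    associatedPrimes.subset_of_injective (Submodule.submoduleOfEquivOfLe hle).injective h
  exact (supportDim_lt_iff.1 (supportDim_dimTrunc_lt n) p hpn).ne hn

end Truncation

section Filtration

variable {R : Type*} [CommRing R] {M : Type*} [AddCommGroup M] [Module R M]

theorem isGreatest_castSucc_of_range_eq_dimSet {l : ℕ} {D : Fin (l + 1) → Submodule R M}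
    (hbot : D 0 = ⊥) {d : Fin l → WithBot ℕ∞} (hd : StrictMono d) (hr : Set.range d = dimSet R M)
    (hD : ∀ i : Fin l, IsGreatest {N : Submodule R M | Module.supportDim R N ≤ d i} (D i.succ))
    (i : Fin l) : IsGreatest {N : Submodule R M | Module.supportDim R N < d i} (D i.castSucc) := by
  have hmem (N : Submodule R M) : N = ⊥ ∨ ∃ k, d k = Module.supportDim R N :=
    or_iff_not_imp_left.2 fun hN => hr.ge ⟨N, hN, rfl⟩
  cases l with
  | zero => exact i.elim0
  | succ l =>
    cases i using Fin.cases with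
    | zero =>
      rw [Fin.castSucc_zero, hbot]
      refine ⟨?_, fun N hN => ((hmem N).resolve_right ?_).le⟩
      · obtain ⟨N, hN, hNd⟩ : d 0 ∈ dimSet R M := hr ▸ Set.mem_range_self 0
        have := Submodule.nontrivial_iff_ne_bot.2 hN
        rw [Set.mem_ofPred_eq, Module.supportDim_eq_bot_of_subsingleton, bot_lt_iff_ne_bot, ← hNd]
        exact Module.supportDim_ne_bot_of_nontrivial R N
      · rintro ⟨k, hk⟩
        exact (hk.trans_lt hN).not_ge (hd.monotone k.zero_le)
    | succ j =>
      rw [← Fin.succ_castSucc]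
      refine ⟨(hD j.castSucc).1.trans_lt (hd j.castSucc_lt_succ), fun N hN => ?_⟩
      obtain rfl | ⟨k, hk⟩ := hmem N
      · exact bot_le
      · have hkj : k < j.succ := hd.lt_iff_lt.1 (hk.trans_lt hN)
        exact (hD j.castSucc).2 (hk.ge.trans (hd.monotone (Fin.le_castSucc_iff.2 hkj)))

variable [IsNoetherian R M]

theorem IsDimensionFiltration.exists_eq_dimTrunc {l : ℕ} {D : Fin (l + 1) → Submodule R M}
    (h : IsDimensionFiltration R M l D) : ∃ d : Fin l → WithBot ℕ∞, Set.range d = dimSet R M ∧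
      ∀ i, ∀ n : ℕ, d i = n → D i.succ = dimTrunc R M (n + 1) ∧ D i.castSucc = dimTrunc R M n := by
  obtain ⟨hbot, d, hd, hr, hD⟩ := h
  refine ⟨d, hr, fun i n hn => ⟨(hD i).unique ?_, ?_⟩⟩
  · simpa only [Nat.cast_add_one, ENat.WithBot.lt_add_one_iff, hn] using
      isGreatest_dimTrunc (R := R) (M := M) (n + 1)
  · exact (hn ▸ isGreatest_castSucc_of_range_eq_dimSet hbot hd hr hD i).unique
      (isGreatest_dimTrunc n)

theorem subsingleton_dimGraded {n : ℕ} (hn : (n : WithBot ℕ∞) ∉ dimSet R M) :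
    Subsingleton (dimGraded R M n) := by
  have hle : dimTrunc R M (n + 1) ≤ dimTrunc R M n := by
    refine le_dimTrunc ((ENat.WithBot.lt_add_one_iff.1 (supportDim_dimTrunc_lt _)).lt_of_ne
      fun h => hn ⟨_, fun hbot => ?_, h⟩)
    rw [hbot, Module.supportDim_eq_bot_of_subsingleton] at h
    exact WithBot.coe_ne_bot h.symm
  exact Submodule.Quotient.subsingleton_iff.2 (Submodule.submoduleOf_eq_top.2 hle)

theorem IsSequentiallyCohenMacaulay.isCohenMacaulay_dimGraded
    (h : IsSequentiallyCohenMacaulay R M) (n : ℕ) : IsCohenMacaulay R (dimGraded R M n) := by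
  obtain ⟨l, D, hfil, hCM⟩ := h
  obtain ⟨d, hr, hD⟩ := hfil.exists_eq_dimTrunc
  by_cases hn : (n : WithBot ℕ∞) ∈ dimSet R M
  · obtain ⟨i, hi⟩ := hr.ge hn
    obtain ⟨hsucc, hcast⟩ := hD i n hi
    have hi := hCM i
    rwa [hsucc, hcast] at hi
  · have := subsingleton_dimGraded hn
    intro P hP
    simp [Module.support_eq_empty] at hP

theorem isSequentiallyCohenMacaulay_iff (hfin : Module.supportDim R M < ⊤) :
    IsSequentiallyCohenMacaulay R M ↔ ∀ n, IsCohenMacaulay R (dimGraded R M n) := by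
  refine ⟨fun h => h.isCohenMacaulay_dimGraded, fun h => ?_⟩
  obtain ⟨l, D, hfil⟩ := exists_isDimensionFiltration (R := R) (M := M)
  obtain ⟨d, hr, hD⟩ := hfil.exists_eq_dimTrunc
  refine ⟨l, D, hfil, fun i => ?_⟩
  obtain ⟨N, hN, hNd⟩ : d i ∈ dimSet R M := hr.le (Set.mem_range_self i)
  have := Submodule.nontrivial_iff_ne_bot.2 hN
  obtain ⟨n, hn⟩ := exists_supportDim_eq_natCast (N := N)
    ((Module.supportDim_le_of_injective _ N.injective_subtype).trans_lt hfin)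
  obtain ⟨hsucc, hcast⟩ := hD i n (hNd.symm.trans hn)
  rw [hsucc, hcast]
  exact h n

end Filtration

section LocalizedFiltration

section Subquotient

variable {R : Type*} [CommRing R] (S : Submonoid R) {M : Type*} [AddCommGroup M] [Module R M]

theorem localized'_submoduleOf (A : Type*) [CommRing A] [Algebra R A] [IsLocalization S A]
    {M' : Type*} [AddCommGroup M'] [Module R M'] [Module A M'] [IsScalarTower R A M']
    (f : M →ₗ[R] M') [IsLocalizedModule S f] (X Y : Submodule R M) :
    (Y.submoduleOf X).localized' A S (X.toLocalized' A S f) =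
      (Y.localized' A S f).submoduleOf (X.localized' A S f) := by
  ext ⟨e, he⟩
  constructor
  · rintro ⟨y, hy, s, h⟩
    have hes := IsLocalizedModule.mk'_eq_iff.1 h
    exact ⟨y, hy, s, IsLocalizedModule.mk'_eq_iff.2 (congrArg Subtype.val hes)⟩
  · intro heY
    obtain ⟨y, hy, s, h⟩ := (Submodule.localized'_inf A S f X Y).ge ⟨he, heY⟩
    have hes := IsLocalizedModule.mk'_eq_iff.1 h
    exact ⟨⟨y, hy.1⟩, hy.2, s, IsLocalizedModule.mk'_eq_iff.2 (Subtype.ext hes)⟩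

/-- Localization commutes with the formation of the subquotient `X / (X ∩ Y)`. -/
noncomputable def localizedSubquotientEquiv (X Y : Submodule R M) :
    (X.localized S ⧸ (Y.localized S).submoduleOf (X.localized S)) ≃ₗ[Localization S]
      LocalizedModule S (X ⧸ Y.submoduleOf X) :=
  (Submodule.quotEquivOfEq _ _ (localized'_submoduleOf S _ _ X Y).symm).trans <|
    LinearEquiv.extendScalarsOfIsLocalization S _ <|
      IsLocalizedModule.linearEquiv S
        ((Y.submoduleOf X).toLocalizedQuotient' (Localization S) S (X.toLocalized S))
        (LocalizedModule.mkLinearMap S _)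

end Subquotient

variable {R : Type*} [CommRing R] {M : Type*} [AddCommGroup M] [Module R M]

variable (R M) in
/-- Localization at `P` lowers the dimension of every associated prime `p ≤ P` of `M` by the same
amount `c`, so that `(R / p)_P` has dimension `dim R / p - c`. -/
def LocalizationShiftsDim (P : Ideal R) [P.IsPrime] (c : ℕ) : Prop :=
  ∀ p ∈ associatedPrimes R M, p ≤ P → ringKrullDim (R ⧸ p) =
    ringKrullDim (Localization.AtPrime P ⧸ p.map (algebraMap R (Localization.AtPrime P))) + c

variable [IsNoetherianRing R] [Module.Finite R M]

theorem LocalizationShiftsDim.localized_dimTrunc {P : Ideal R} [P.IsPrime] {c : ℕ}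
    (h : LocalizationShiftsDim R M P c) (n : ℕ) :
    (dimTrunc R M (n + c)).localized P.primeCompl =
      dimTrunc (Localization.AtPrime P) (LocalizedModule.AtPrime P M) n := by
  refine eq_dimTrunc (supportDim_lt_iff.2 fun q hq => ?_) fun q hq => ?_
  · obtain ⟨p, hp, hpP, rfl⟩ := (mem_associatedPrimes_iff_of_isLocalizedModule _ P
      ((dimTrunc R M (n + c)).toLocalized P.primeCompl)).1 hq
    have hlt := supportDim_lt_iff.1 (supportDim_dimTrunc_lt (n + c)) p hp
    rw [h p (associatedPrimes.subset_of_injective (Submodule.injective_subtype _) hp) hpP] at hlt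
    by_contra! hle
    refine hlt.not_ge ?_
    rw [Nat.cast_add]
    gcongr
  · obtain ⟨p, hp, hpP, rfl⟩ := (mem_associatedPrimes_iff_of_isLocalizedModule _ P
      ((dimTrunc R M (n + c)).toLocalizedQuotient P.primeCompl)).1 hq
    have hle := le_ringKrullDim_of_mem_associatedPrimes_quotient_dimTrunc hp
    rw [h p (associatedPrimes_quotient_dimTrunc_subset _ hp) hpP, Nat.cast_add] at hle
    exact (ENat.WithBot.add_le_add_natCast_right_iff).1 hle

theorem LocalizationShiftsDim.nonempty_dimGraded_equiv {P : Ideal R} [P.IsPrime] {c : ℕ}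
    (h : LocalizationShiftsDim R M P c) (n : ℕ) :
    Nonempty (dimGraded (Localization.AtPrime P) (LocalizedModule.AtPrime P M) n
      ≃ₗ[Localization.AtPrime P] LocalizedModule.AtPrime P (dimGraded R M (n + c))) := by
  have e := Nonempty.intro <| localizedSubquotientEquiv P.primeCompl (dimTrunc R M (n + c + 1))
    (dimTrunc R M (n + c))
  have hsucc := h.localized_dimTrunc (n + 1)
  rw [Nat.add_right_comm] at hsucc
  rwa [h.localized_dimTrunc n, hsucc] at e

end LocalizedFiltration

section LocalToGlobal

variable {R : Type*} [CommRing R] [IsNoetherianRing R] {M : Type*} [AddCommGroup M] [Module R M]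
  [Module.Finite R M] {P : Ideal R} [P.IsPrime]

theorem supportDim_lt_top_of_localizationShiftsDim
    (hmax : ∀ (m : Ideal R) [m.IsMaximal], LocalizationShiftsDim R M m 0) :
    Module.supportDim R M < ⊤ := by
  refine supportDim_lt_top_of_forall_mem_associatedPrimes fun p hp => ?_
  obtain ⟨m, _, hpm⟩ := Ideal.exists_le_maximal p hp.isPrime.ne_top
  rw [hmax m p hp hpm, Nat.cast_zero, add_zero]
  exact (ringKrullDim_quotient_le _).trans_lt ringKrullDim_lt_top

theorem exists_ringKrullDim_quotient_map_eq_natCast {m : Ideal R} [m.IsPrime] (hPm : P ≤ m) :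
    ∃ c : ℕ, ringKrullDim
      (Localization.AtPrime m ⧸ P.map (algebraMap R (Localization.AtPrime m))) = c := by
  have := Ideal.isPrime_map_of_isLocalizationAtPrime (S := Localization.AtPrime m) m hPm
  rw [← Module.supportDim_quotient_eq_ringKrullDim]
  exact exists_supportDim_eq_natCast (supportDim_lt_top (A := Localization.AtPrime m))

theorem localizationShiftsDim_of_le {m : Ideal R} [m.IsMaximal] (hm : LocalizationShiftsDim R M m 0)
    (hCM : ∀ n, IsCohenMacaulay R (dimGraded R M n)) (hPm : P ≤ m) {c : ℕ}
    (hc : ringKrullDim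
      (Localization.AtPrime m ⧸ P.map (algebraMap R (Localization.AtPrime m))) = c) :
    LocalizationShiftsDim R M P c := by
  intro p hp hpP
  have := hp.isPrime
  have hpm := hpP.trans hPm
  have hdim := hm p hp hpm
  rw [Nat.cast_zero, add_zero] at hdim
  -- The Cohen-Macaulay module `(dimGraded R M n)_m`, where `n = dim R / p`, has `pR_m` as an
  -- associated prime, so its dimension is `n`; localizing it at `P` lowers it by `dim R_m / PR_m`.
  obtain ⟨n, hn⟩ := exists_ringKrullDim_quotient_map_eq_natCast hpm
  have hpG := mem_associatedPrimes_dimGraded hp (hdim.trans hn)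
  obtain ⟨k, hk⟩ := isCohenMacaulay_iff.1 (hCM n) ⟨m, inferInstance⟩
    (mem_support_of_mem_associatedPrimes hpG hpm) ‹_›
  obtain ⟨j, hj, hjk⟩ := hk.exists_localizedModule_of_le hPm
    (mem_support_of_mem_associatedPrimes hpG hpP)
  have hkdim := hk.ringKrullDim_quotient_eq ((mem_associatedPrimes_iff_of_isLocalizedModule _ m
    (LocalizedModule.mkLinearMap m.primeCompl _)).2 ⟨p, hpG, hpm, rfl⟩)
  have hjdim := hj.ringKrullDim_quotient_eq ((mem_associatedPrimes_iff_of_isLocalizedModule _ P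
    (LocalizedModule.mkLinearMap P.primeCompl _)).2 ⟨p, hpG, hpP, rfl⟩)
  rw [hdim, hkdim, hjdim, ← hjk, hc, add_comm]

theorem isCohenMacaulay_dimGraded_localization
    (hmax : ∀ (m : Ideal R) [m.IsMaximal], LocalizationShiftsDim R M m 0)
    (hCM : ∀ n, IsCohenMacaulay R (dimGraded R M n)) (P : Ideal R) [P.IsPrime] (n : ℕ) :
    IsCohenMacaulay (Localization.AtPrime P)
      (dimGraded (Localization.AtPrime P) (LocalizedModule.AtPrime P M) n) := by
  obtain ⟨m, _, hPm⟩ := Ideal.exists_le_maximal P (Ideal.IsPrime.ne_top ‹_›)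
  obtain ⟨c, hc⟩ := exists_ringKrullDim_quotient_map_eq_natCast hPm
  obtain ⟨e⟩ := (localizationShiftsDim_of_le (hmax m) hCM hPm hc).nonempty_dimGraded_equiv n
  refine isCohenMacaulay_iff_of_isLocalRing.2 fun _ => ?_
  have hsupp : ⟨P, ‹_›⟩ ∈ Module.support R (dimGraded R M (n + c)) :=
    Module.mem_support_iff.2 e.symm.toEquiv.nontrivial
  obtain ⟨k, hk⟩ := isCohenMacaulay_iff.1 (hCM (n + c)) ⟨m, inferInstance⟩
    (Module.mem_support_mono ((PrimeSpectrum.asIdeal_le_asIdeal _ _).1 hPm) hsupp) ‹_›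
  obtain ⟨j, hj, -⟩ := hk.exists_localizedModule_of_le hPm hsupp
  exact ⟨j, hj.of_equiv e.symm⟩

theorem isCohenMacaulay_dimGraded_of_localization
    (hmax : ∀ (m : Ideal R) [m.IsMaximal], LocalizationShiftsDim R M m 0)
    (h : ∀ P ∈ Module.support R M, ∀ n, IsCohenMacaulay (Localization.AtPrime P.asIdeal)
      (dimGraded (Localization.AtPrime P.asIdeal) (LocalizedModule.AtPrime P.asIdeal M) n))
    (n : ℕ) : IsCohenMacaulay R (dimGraded R M n) := by
  refine isCohenMacaulay_iff.2 fun P hP _ => ?_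
  obtain ⟨e⟩ := (hmax P.asIdeal).nonempty_dimGraded_equiv n
  have : Nontrivial (LocalizedModule.AtPrime P.asIdeal (dimGraded R M n)) :=
    Module.mem_support_iff.1 hP
  obtain ⟨k, hk⟩ := isCohenMacaulay_iff_of_isLocalRing.1
    (h P (support_dimGraded_subset n hP) n) e.toEquiv.nontrivial
  exact ⟨k, hk.of_equiv e⟩

end LocalToGlobal

end SeqCM

theorem theorem1p1 {R : Type*} [CommRing R] [IsNoetherianRing R]
    {M : Type*} [AddCommGroup M] [Module R M] [Module.Finite R M]
    (hdim : ∀ p ∈ associatedPrimes R M, ∀ (P : Ideal R) [P.IsMaximal], p ≤ P →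
      ringKrullDim (R ⧸ p) =
        ringKrullDim (Localization.AtPrime P ⧸ p.map (algebraMap R (Localization.AtPrime P)))) :
    SeqCM.IsSequentiallyCohenMacaulay R M ↔
      ∀ P ∈ Module.support R M,
        SeqCM.IsSequentiallyCohenMacaulay (Localization.AtPrime P.asIdeal)
          (LocalizedModule.AtPrime P.asIdeal M) := by
  have hmax (m : Ideal R) [m.IsMaximal] : SeqCM.LocalizationShiftsDim R M m 0 := fun p hp hpm => by
    rw [hdim p hp m hpm, Nat.cast_zero, add_zero]
  rw [SeqCM.isSequentiallyCohenMacaulay_iff (SeqCM.supportDim_lt_top_of_localizationShiftsDim hmax)]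
  constructor
  · intro hCM P _
    exact (SeqCM.isSequentiallyCohenMacaulay_iff SeqCM.supportDim_lt_top).2
      (SeqCM.isCohenMacaulay_dimGraded_localization hmax hCM P.asIdeal)
  · intro h
    exact SeqCM.isCohenMacaulay_dimGraded_of_localization hmax fun P hP =>
      (h P hP).isCohenMacaulay_dimGraded
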